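/- Let $V=(V,Y,\mathbf 1,\omega)$ be a vertex operator algebra over $\mathbb C$ and let $W_1,W_2,W_3$ be weak $V$-modules (no grading or finiteness is assumed). Let $\mathcal Y$ be an intertwining operator of type $\binom{W_3}{W_1\,W_2}$, that is, a linear map $$W_1\otimes W_2\to W_3\{x\},\qquad w_1\otimes w_2\mapsto \mathcal Y(w_1,x)w_2=\sum_{n\in\mathbb C}(w_1)_n w_2\,x^{-n-1},$$ which involves no powers of $\log x$ and satisfies lower truncation (for all $w_1\in W_1$, $w_2\in W_2$, $n\in\mathbb C$, $(w_1)_{n+m}w_2=0$ for all sufficiently large $m\in\mathbb N$), the Jacobi identity, and the $L_{-1}$-derivative property $\mathcal Y(L_{-1}w_1,x)=\frac{d}{dx}\mathcal Y(w_1,x)$. For a vector $w$ of a $V$-module $W$ let $\langle w\rangle\subseteq W$ be the $V$-submodule generated by $w$, that is, the smallest subspace of $W$ that contains $w$ and is stable under all modes $v_n$, where $v\in V$, $n\in\mathbb Z$ and $Y_W(v,x)=\sum_{n\in\mathbb Z}v_n x^{-n-1}$. Let $w_1\in W_1$ and $w_2\in W_2$ be such that $\mathcal Y(w_1,x)w_2=0$.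 Then $\mathcal Y(v_1,x)v_2=0$ for all $v_1\in\langle w_1\rangle$ and all $v_2\in\langle w_2\rangle$. -/

import Mathlib

/-! Formal series are handled through their coefficients.  A vertex operator
`Y(u,x) = ∑ u_n x^(-n-1)` is Mathlib's `VertexOperator`, i.e. a linear map to Laurent series
(so lower truncation is built in), and `u_n` is its `n`-th normalized coefficient
`VertexOperator.ncoeff`.

The three definitions below are the coefficients of `x₀^(-l-1) x₁^(-m-1) x₂^(-n-1)` in the three
terms of the Jacobi identity, where each binomial `(x ± y)^l` is expanded in nonnegative powers of
`y`.  The powers of `x₁` and `x₀` are integral; the exponents of `x₂` lie in `A`, which is `ℤ` for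
modules and `ℂ` for intertwining operators.  All sums are finite by lower truncation. -/

/-- Coefficient of `x₀^(-l-1) x₁^(-m-1) x₂^(-n-1)` in
`x₀⁻¹ δ((x₁ - x₂)/x₀) a(x₁) b(x₂) w`, where `a(x) = ∑ a_p x^(-p-1)`, `b(x) = ∑ b_q x^(-q-1)` and
`x₀⁻¹ δ((x₁ - x₂)/x₀) = ∑_{l, i} (-1)^i (l choose i) x₀^(-l-1) x₁^(l-i) x₂^i`. -/
noncomputable def jacobiProduct {A W₂ W₃ : Type*} [Ring A] [AddCommGroup W₃] [Module ℂ W₃]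
    (a : ℤ → W₃ → W₃) (b : A → W₂ → W₃) (l m : ℤ) (n : A) (w : W₂) : W₃ :=
  ∑ᶠ i : ℕ, ((-1 : ℂ) ^ i * ((Ring.choose l i : ℤ) : ℂ)) • a (m + l - i) (b (n + i) w)

/-- Coefficient of `x₀^(-l-1) x₁^(-m-1) x₂^(-n-1)` in
`x₀⁻¹ δ((-x₂ + x₁)/x₀) b(x₂) a(x₁) w`, where
`x₀⁻¹ δ((-x₂ + x₁)/x₀) = x₀⁻¹ δ((x₂ - x₁)/(-x₀))
  = ∑_{l, i} (-1)^l (-1)^i (l choose i) x₀^(-l-1) x₂^(l-i) x₁^i`. -/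
noncomputable def jacobiReverse {A W₂ W₃ : Type*} [Ring A] [AddCommGroup W₃] [Module ℂ W₃]
    (a : ℤ → W₂ → W₂) (b : A → W₂ → W₃) (l m : ℤ) (n : A) (w : W₂) : W₃ :=
  ∑ᶠ i : ℕ, ((-1 : ℂ) ^ l * (-1 : ℂ) ^ i * ((Ring.choose l i : ℤ) : ℂ)) •
    b (n + (l : A) - i) (a (m + i) w)

/-- Coefficient of `x₀^(-l-1) x₁^(-m-1) x₂^(-n-1)` in
`x₂⁻¹ δ((x₁ - x₀)/x₂) b(a(x₀) w₁, x₂) w₂`, where `b(w, x) = ∑ b_q(w) x^(-q-1)` and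
`x₂⁻¹ δ((x₁ - x₀)/x₂) = ∑_{p, i} (-1)^i (p choose i) x₂^(-p-1) x₁^(p-i) x₀^i`; the relevant
term is `p = i - m - 1`, for which `(-1)^i (p choose i) = (m choose i)`. -/
noncomputable def jacobiIterate {A W₁ W₂ W₃ : Type*} [Ring A] [AddCommGroup W₃] [Module ℂ W₃]
    (a : ℤ → W₁ → W₁) (b : A → W₁ → W₂ → W₃) (l m : ℤ) (n : A) (w₁ : W₁) (w₂ : W₂) : W₃ :=
  ∑ᶠ i : ℕ, ((Ring.choose m i : ℤ) : ℂ) • b ((m : A) + n - i) (a (l + i) w₁) w₂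

/-- A vertex operator algebra `(V, Y, 𝟏, ω)` over `ℂ`, of central charge `c`. -/
structure VertexOperatorAlgebra (V : Type*) [AddCommGroup V] [Module ℂ V] where
  /-- the vertex operator map `v ↦ Y(v,x)` -/
  Y : V →ₗ[ℂ] VertexOperator ℂ V
  /-- the vacuum vector `𝟏` -/
  vacuum : V
  /-- the conformal vector `ω` -/
  ω : V
  /-- the central charge -/
  c : ℂ
  /-- `Y(𝟏,x) = 1` -/
  vacuum_mode : ∀ n : ℤ, (Y vacuum).ncoeff n = if n = -1 then 1 else 0
  /-- `Y(v,x)𝟏` has no negative powers of `x` -/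
  creation_nonneg : ∀ (v : V) (n : ℤ), 0 ≤ n → (Y v).ncoeff n vacuum = 0
  /-- `Y(v,x)𝟏` has constant term `v` -/
  creation_neg_one : ∀ v : V, (Y v).ncoeff (-1) vacuum = v
  jacobi : ∀ (u v w : V) (l m n : ℤ),
    jacobiProduct (fun p x => (Y u).ncoeff p x) (fun q x => (Y v).ncoeff q x) l m n w
      - jacobiReverse (fun p x => (Y u).ncoeff p x) (fun q x => (Y v).ncoeff q x) l m n w
      = jacobiIterate (fun p x => (Y u).ncoeff p x) (fun q y x => (Y y).ncoeff q x) l m n v w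
  /-- the Virasoro relations for `L_n = ω_{n+1}` -/
  virasoro : ∀ m n : ℤ,
    (Y ω).ncoeff (m + 1) * (Y ω).ncoeff (n + 1) - (Y ω).ncoeff (n + 1) * (Y ω).ncoeff (m + 1)
      = ((m : ℂ) - n) • (Y ω).ncoeff (m + n + 1)
        + (if m + n = 0 then ((m : ℂ) ^ 3 - m) / 12 * c else 0) • (1 : Module.End ℂ V)
  /-- `Y(L_{-1}v,x) = d/dx Y(v,x)` -/
  derivative : ∀ (v : V) (n : ℤ),
    (Y ((Y ω).ncoeff 0 v)).ncoeff n = (-(n : ℂ)) • (Y v).ncoeff (n - 1)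
  /-- `V` is the direct sum of the weight spaces `V_(n)`, `n ∈ ℤ`, the eigenspaces of `L_0` -/
  grading : DirectSum.IsInternal
    fun n : ℤ => Module.End.eigenspace ((Y ω).ncoeff 1 : Module.End ℂ V) (n : ℂ)
  weight_finite : ∀ n : ℤ, FiniteDimensional ℂ
    (Module.End.eigenspace ((Y ω).ncoeff 1 : Module.End ℂ V) (n : ℂ))
  weight_bounded : ∃ N : ℤ, ∀ n < N,
    Module.End.eigenspace ((Y ω).ncoeff 1 : Module.End ℂ V) (n : ℂ) = ⊥

/-- A (weak) module `(W, Y_W)` for the vertex operator algebra `VOA`. -/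
structure VertexOperatorAlgebra.WeakModule {V : Type*} [AddCommGroup V] [Module ℂ V]
    (VOA : VertexOperatorAlgebra V) (W : Type*) [AddCommGroup W] [Module ℂ W] where
  /-- the vertex operator map `v ↦ Y_W(v,x)` -/
  Y : V →ₗ[ℂ] VertexOperator ℂ W
  /-- `Y_W(𝟏,x) = 1` -/
  vacuum_mode : ∀ n : ℤ, (Y VOA.vacuum).ncoeff n = if n = -1 then 1 else 0
  jacobi : ∀ (u v : V) (w : W) (l m n : ℤ),
    jacobiProduct (fun p x => (Y u).ncoeff p x) (fun q x => (Y v).ncoeff q x) l m n w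
      - jacobiReverse (fun p x => (Y u).ncoeff p x) (fun q x => (Y v).ncoeff q x) l m n w
      = jacobiIterate (fun p x => (VOA.Y u).ncoeff p x) (fun q y x => (Y y).ncoeff q x) l m n v w
  /-- the Virasoro relations for `L_n = ω_{n+1}` -/
  virasoro : ∀ m n : ℤ,
    (Y VOA.ω).ncoeff (m + 1) * (Y VOA.ω).ncoeff (n + 1)
        - (Y VOA.ω).ncoeff (n + 1) * (Y VOA.ω).ncoeff (m + 1)
      = ((m : ℂ) - n) • (Y VOA.ω).ncoeff (m + n + 1)
        + (if m + n = 0 then ((m : ℂ) ^ 3 - m) / 12 * VOA.c else 0) • (1 : Module.End ℂ W)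
  /-- `Y_W(L_{-1}v,x) = d/dx Y_W(v,x)` -/
  derivative : ∀ (v : V) (n : ℤ),
    (Y ((VOA.Y VOA.ω).ncoeff 0 v)).ncoeff n = (-(n : ℂ)) • (Y v).ncoeff (n - 1)

/-- A subspace is a `V`-submodule if it is stable under all modes `v_n`. -/
def VertexOperatorAlgebra.WeakModule.IsSubmodule {V : Type*} [AddCommGroup V] [Module ℂ V]
    {VOA : VertexOperatorAlgebra V} {W : Type*} [AddCommGroup W] [Module ℂ W]
    (M : VOA.WeakModule W) (N : Submodule ℂ W) : Prop :=
  ∀ (v : V) (n : ℤ), ∀ w ∈ N, (M.Y v).ncoeff n w ∈ N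

/-- The `V`-submodule `⟨w⟩` generated by `w`: the smallest `V`-submodule containing `w`. -/
def VertexOperatorAlgebra.WeakModule.generated {V : Type*} [AddCommGroup V] [Module ℂ V]
    {VOA : VertexOperatorAlgebra V} {W : Type*} [AddCommGroup W] [Module ℂ W]
    (M : VOA.WeakModule W) (w : W) : Submodule ℂ W :=
  sInf {N : Submodule ℂ W | M.IsSubmodule N ∧ w ∈ N}

/-- A logarithmic intertwining operator of type `(W₃ over W₁ W₂)`:
`𝒴(w₁,x)w₂ = ∑_k ∑_{n ∈ ℂ} (w₁)_{n,k} w₂ x^(-n-1) (log x)^k`, with `log x` a formal variable. -/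
structure LogIntertwiningOperator {V : Type*} [AddCommGroup V] [Module ℂ V]
    {VOA : VertexOperatorAlgebra V} {W₁ W₂ W₃ : Type*}
    [AddCommGroup W₁] [Module ℂ W₁] [AddCommGroup W₂] [Module ℂ W₂]
    [AddCommGroup W₃] [Module ℂ W₃]
    (M₁ : VOA.WeakModule W₁) (M₂ : VOA.WeakModule W₂) (M₃ : VOA.WeakModule W₃) where
  /-- `mode n k w₁ w₂ = (w₁)_{n,k} w₂` -/
  mode : ℂ → ℕ → W₁ →ₗ[ℂ] W₂ →ₗ[ℂ] W₃
  /-- `𝒴(w₁,x)w₂` is a polynomial in `log x` -/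
  log_bounded : ∀ (w₁ : W₁) (w₂ : W₂), ∃ K : ℕ, ∀ (n : ℂ) (k : ℕ), K < k → mode n k w₁ w₂ = 0
  lower_truncation : ∀ (w₁ : W₁) (w₂ : W₂) (n : ℂ) (k : ℕ),
    ∃ N : ℕ, ∀ m : ℕ, N ≤ m → mode (n + m) k w₁ w₂ = 0
  /-- the coefficient of `(log x₂)^k` in the Jacobi identity -/
  jacobi : ∀ (v : V) (w₁ : W₁) (w₂ : W₂) (l m : ℤ) (n : ℂ) (k : ℕ),
    jacobiProduct (fun p x => (M₃.Y v).ncoeff p x) (fun q x => mode q k w₁ x) l m n w₂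
      - jacobiReverse (fun p x => (M₂.Y v).ncoeff p x) (fun q x => mode q k w₁ x) l m n w₂
      = jacobiIterate (fun p x => (M₁.Y v).ncoeff p x) (fun q y x => mode q k y x) l m n w₁ w₂
  /-- `𝒴(L_{-1}w₁,x) = d/dx 𝒴(w₁,x)`, where `d/dx log x = x⁻¹` -/
  derivative : ∀ (w₁ : W₁) (w₂ : W₂) (n : ℂ) (k : ℕ),
    mode n k ((M₁.Y VOA.ω).ncoeff 0 w₁) w₂
      = (-n) • mode (n - 1) k w₁ w₂ + ((k : ℂ) + 1) • mode (n - 1) (k + 1) w₁ w₂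

/-- The formal series `𝒴(w₁,x)w₂`: its value at `s`, `k` is the coefficient of
`x^s (log x)^k`. -/
def LogIntertwiningOperator.series {V : Type*} [AddCommGroup V] [Module ℂ V]
    {VOA : VertexOperatorAlgebra V} {W₁ W₂ W₃ : Type*}
    [AddCommGroup W₁] [Module ℂ W₁] [AddCommGroup W₂] [Module ℂ W₂]
    [AddCommGroup W₃] [Module ℂ W₃]
    {M₁ : VOA.WeakModule W₁} {M₂ : VOA.WeakModule W₂} {M₃ : VOA.WeakModule W₃}
    (𝒴 : LogIntertwiningOperator M₁ M₂ M₃) (w₁ : W₁) (w₂ : W₂) : ℂ → ℕ → W₃ :=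
  fun s k => 𝒴.mode (-s - 1) k w₁ w₂

/-- A logarithmic intertwining operator is an intertwining operator if no `log x` appears. -/
def LogIntertwiningOperator.IsIntertwiningOperator {V : Type*} [AddCommGroup V] [Module ℂ V]
    {VOA : VertexOperatorAlgebra V} {W₁ W₂ W₃ : Type*}
    [AddCommGroup W₁] [Module ℂ W₁] [AddCommGroup W₂] [Module ℂ W₂]
    [AddCommGroup W₃] [Module ℂ W₃]
    {M₁ : VOA.WeakModule W₁} {M₂ : VOA.WeakModule W₂} {M₃ : VOA.WeakModule W₃}
    (𝒴 : LogIntertwiningOperator M₁ M₂ M₃) : Prop :=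
  ∀ (w₁ : W₁) (w₂ : W₂) (s : ℂ) (k : ℕ), k ≠ 0 → 𝒴.series w₁ w₂ s k = 0

/-! When `𝒴(w₁,x)` kills `w₂`, the product term of the Jacobi identity on `w₁, w₂` vanishes, so the
reverse and iterate terms agree up to sign. Each of these can be removed by a suitable choice of
indices or annihilator. A large power of `x₀` removes the iterate, so the annihilator of `w₁` in
`W₂` is a submodule and contains `⟨w₂⟩` (`mode_ncoeff_right`). Once all of `⟨w₂⟩` is killed, the
reverse term drops out, and the set of vectors of `W₁` whose operators kill `⟨w₂⟩` is a submodule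
too (`mode_ncoeff_left`). The argument runs separately for each power of `log x`. -/

theorem VertexOperator.exists_ncoeff_eq_zero {W : Type*} [AddCommGroup W] [Module ℂ W]
    (A : VertexOperator ℂ W) (w : W) : ∃ N : ℕ, ∀ n : ℤ, (N : ℤ) ≤ n → A.ncoeff n w = 0 := by
  refine ⟨(-((HahnModule.of ℂ).symm (A w)).order).toNat, fun n hn => ?_⟩
  exact A.ncoeff_eq_zero_of_lt_order n w (by omega)

theorem VertexOperatorAlgebra.WeakModule.generated_le {V : Type*} [AddCommGroup V] [Module ℂ V]
    {VOA : VertexOperatorAlgebra V} {W : Type*} [AddCommGroup W] [Module ℂ W]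
    (M : VOA.WeakModule W) {w : W} {N : Submodule ℂ W} (hN : M.IsSubmodule N) (hw : w ∈ N) :
    M.generated w ≤ N :=
  sInf_le ⟨hN, hw⟩

theorem VertexOperatorAlgebra.WeakModule.isSubmodule_generated
    {V : Type*} [AddCommGroup V] [Module ℂ V]
    {VOA : VertexOperatorAlgebra V} {W : Type*} [AddCommGroup W] [Module ℂ W]
    (M : VOA.WeakModule W) (w : W) : M.IsSubmodule (M.generated w) := fun v n u hu =>
  Submodule.mem_sInf.2 fun _ hN => hN.1 v n u (Submodule.mem_sInf.1 hu _ hN)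

namespace LogIntertwiningOperator

variable {V : Type*} [AddCommGroup V] [Module ℂ V]
  {VOA : VertexOperatorAlgebra V} {W₁ W₂ W₃ : Type*}
  [AddCommGroup W₁] [Module ℂ W₁] [AddCommGroup W₂] [Module ℂ W₂]
  [AddCommGroup W₃] [Module ℂ W₃]
  {M₁ : VOA.WeakModule W₁} {M₂ : VOA.WeakModule W₂} {M₃ : VOA.WeakModule W₃}
  (𝒴 : LogIntertwiningOperator M₁ M₂ M₃)

theorem series_eq_zero_iff {w₁ : W₁} {w₂ : W₂} :
    𝒴.series w₁ w₂ = 0 ↔ ∀ n k, 𝒴.mode n k w₁ w₂ = 0 := by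
  refine ⟨fun h n k => ?_, fun h => funext₂ fun s k => h _ k⟩
  simpa [series] using congrFun₂ h (-n - 1) k

theorem jacobiProduct_eq_zero {w₁ : W₁} {w₂ : W₂} (h : ∀ n k, 𝒴.mode n k w₁ w₂ = 0)
    (v : V) (l m : ℤ) (n : ℂ) (k : ℕ) :
    jacobiProduct (fun p x => (M₃.Y v).ncoeff p x) (fun q x => 𝒴.mode q k w₁ x) l m n w₂ = 0 := by
  simp [jacobiProduct, h]

/-- The vectors annihilated by `𝒴(w₁,x)` form a `V`-submodule: by weak commutativity
`(x₁ - x₂)^l 𝒴(w₁,x₂) Y(v,x₁) w₂ = 0` for large `l`, and `(-x₂ + x₁)^l` can be cancelled. -/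
theorem mode_ncoeff_right {w₁ : W₁} {w₂ : W₂} (h : ∀ n k, 𝒴.mode n k w₁ w₂ = 0)
    (v : V) (p : ℤ) : ∀ n k, 𝒴.mode n k w₁ ((M₂.Y v).ncoeff p w₂) = 0 := by
  obtain ⟨L, hL⟩ := (M₁.Y v).exists_ncoeff_eq_zero w₁
  obtain ⟨N, hN⟩ := (M₂.Y v).exists_ncoeff_eq_zero w₂
  -- Downward induction on the mode `m`, starting from the truncation bound `N`; `d` bounds how far
  -- `m` lies below it.
  have key : ∀ (d : ℕ) (m : ℤ), (N : ℤ) ≤ m + d →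
      ∀ n k, 𝒴.mode n k w₁ ((M₂.Y v).ncoeff m w₂) = 0 := by
    intro d
    induction d with
    | zero =>
      intro m hm n k
      rw [hN m (by simpa using hm), map_zero]
    | succ d ih =>
      intro m hm n k
      -- With `l = L` the iterate only involves `v_{L+i} w₁ = 0`. In the reverse term, the summands
      -- with `i > 0` contain the higher modes `v_{m+i}`, covered by induction; the shift by `L`
      -- makes the `i = 0` summand `±(w₁)_{n,k} v_m w₂`.
      have hJ := 𝒴.jacobi v w₁ w₂ L m (n - (L : ℂ)) k
      have hI : jacobiIterate (fun p x => (M₁.Y v).ncoeff p x) (fun q y x => 𝒴.mode q k y x)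
          L m (n - (L : ℂ)) w₁ w₂ = 0 := by
        simp only [jacobiIterate]
        refine finsum_eq_zero_of_forall_eq_zero fun i => ?_
        rw [hL _ (by omega)]
        simp
      rw [𝒴.jacobiProduct_eq_zero h, hI, zero_sub, neg_eq_zero, jacobiReverse,
        finsum_eq_single _ 0] at hJ
      · simpa using hJ
      · intro i hi
        rw [ih (m + i) (by push_cast at hm; omega), smul_zero]
  exact key (N - p).toNat p (by omega)

/-- If `𝒴(w₁,x)` annihilates a `V`-submodule `N`, then so does `𝒴(v_p w₁,x)`. -/
theorem mode_ncoeff_left {w₁ : W₁} {N : Submodule ℂ W₂} (hN : M₂.IsSubmodule N)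
    (h : ∀ u ∈ N, ∀ n k, 𝒴.mode n k w₁ u = 0) (v : V) (p : ℤ) :
    ∀ u ∈ N, ∀ n k, 𝒴.mode n k ((M₁.Y v).ncoeff p w₁) u = 0 := by
  intro u hu n k
  -- Since `(0 choose i) = 0` for `i > 0`, taking `m = 0` reduces the iterate to the single
  -- coefficient `(v_p w₁)_{n,k} u`.
  have hJ := 𝒴.jacobi v w₁ u p 0 n k
  have hR : jacobiReverse (fun p x => (M₂.Y v).ncoeff p x) (fun q x => 𝒴.mode q k w₁ x)
      p 0 n u = 0 := by
    simp only [jacobiReverse]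
    refine finsum_eq_zero_of_forall_eq_zero fun i => ?_
    rw [h _ (hN v _ u hu), smul_zero]
  rw [𝒴.jacobiProduct_eq_zero (h u hu), hR, sub_zero, jacobiIterate, finsum_eq_single _ 0] at hJ
  · simpa using hJ.symm
  · intro i hi
    simp [Ring.choose_zero_pos ℤ (Nat.pos_of_ne_zero hi)]

theorem mode_eq_zero_of_mem_generated {w₁ : W₁} {w₂ : W₂} (h : ∀ n k, 𝒴.mode n k w₁ w₂ = 0)
    {v₁ : W₁} (hv₁ : v₁ ∈ M₁.generated w₁) {v₂ : W₂} (hv₂ : v₂ ∈ M₂.generated w₂) (n : ℂ) (k : ℕ) :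
    𝒴.mode n k v₁ v₂ = 0 := by
  let K₂ : Submodule ℂ W₂ := ⨅ (n : ℂ) (k : ℕ), LinearMap.ker (𝒴.mode n k w₁)
  have h₂ : M₂.generated w₂ ≤ K₂ := by
    refine M₂.generated_le (fun v p u hu => ?_) (by simpa [K₂] using h)
    simp only [K₂, Submodule.mem_iInf, LinearMap.mem_ker] at hu ⊢
    exact 𝒴.mode_ncoeff_right hu v p
  -- Annihilating `w₂` alone would not suffice here: the reverse term applies modes of `v` to `u`,
  -- so `u` must range over a submodule.
  let K₁ : Submodule ℂ W₁ := ⨅ (u ∈ M₂.generated w₂) (n : ℂ) (k : ℕ),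
    LinearMap.ker ((𝒴.mode n k).flip u)
  have h₁ : M₁.generated w₁ ≤ K₁ := by
    refine M₁.generated_le (fun v p u hu => ?_) ?_
    · simp only [K₁, Submodule.mem_iInf, LinearMap.mem_ker, LinearMap.flip_apply] at hu ⊢
      exact 𝒴.mode_ncoeff_left (M₂.isSubmodule_generated w₂) hu v p
    · simp only [K₁, Submodule.mem_iInf, LinearMap.mem_ker, LinearMap.flip_apply]
      intro u hu
      simpa [K₂] using h₂ hu
  have := h₁ hv₁
  simp only [K₁, Submodule.mem_iInf, LinearMap.mem_ker, LinearMap.flip_apply] at this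
  exact this v₂ hv₂ n k

end LogIntertwiningOperator

theorem mainTheorem11 {V : Type*} [AddCommGroup V] [Module ℂ V]
    (VOA : VertexOperatorAlgebra V) {W₁ W₂ W₃ : Type*}
    [AddCommGroup W₁] [Module ℂ W₁] [AddCommGroup W₂] [Module ℂ W₂]
    [AddCommGroup W₃] [Module ℂ W₃]
    (M₁ : VOA.WeakModule W₁) (M₂ : VOA.WeakModule W₂) (M₃ : VOA.WeakModule W₃)
    (𝒴 : LogIntertwiningOperator M₁ M₂ M₃) (h𝒴 : 𝒴.IsIntertwiningOperator)
    (w₁ : W₁) (w₂ : W₂) (h : 𝒴.series w₁ w₂ = 0) :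
    ∀ v₁ ∈ M₁.generated w₁, ∀ v₂ ∈ M₂.generated w₂, 𝒴.series v₁ v₂ = 0 := by
  intro v₁ hv₁ v₂ hv₂
  exact 𝒴.series_eq_zero_iff.2 (𝒴.mode_eq_zero_of_mem_generated (𝒴.series_eq_zero_iff.1 h) hv₁ hv₂)
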